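/- Let $\Omega\subset\mathbb R^n$ be a bounded open set (neither connectedness nor regularity of the boundary is needed; in particular $\Omega$ may be any bounded domain with Lipschitz boundary), let $F\in (L^2(\Omega))^n$ and $H\in L^2(\Omega)$, and let $\varphi:\Omega\times\mathbb R^n\to\mathbb R$ be measurable in $x$ and satisfy: (C1) there is $\alpha>0$ with $0\le\varphi(x,\xi)\le\alpha|\xi|$ for all $x\in\Omega$, $\xi\in\mathbb R^n$; (C2) $\xi\mapsto\varphi(x,\xi)$ is a norm on $\mathbb R^n$ for every $x\in\Omega$. Put $\varphi^0(x,\xi)=\sup\{\xi\cdot p:\varphi(x,p)\le1\}$ and $\mathring H^1(\Omega)=\{u\in H^1(\Omega):\int_\Omega u=0\}$. For $b\in(L^2(\Omega))^n$ and $u\in\mathring H^1(\Omega)$ let $E(b)=\int_\Omega\varphi(x,b+F)\,dx$, $G(u)=\int_\Omega Hu\,dx$ and $I(u)=E(\nabla u)+G(u)$. Consider the primal problem $$(P)\qquad \inf_{u\in\mathring H^1(\Omega)} I(u)$$ and its Fenchel–Rockafellar dual $$(D)\qquad \sup_{b\in (L^2(\Omega))^n}\{-E^*(b)-G^*(-\nabla^*b)\},$$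 where $E^*,G^*$ are the convex conjugates and $\nabla^*$ is the adjoint of $\nabla:\mathring H^1(\Omega)\to (L^2(\Omega))^n$. Let $$\mathcal D_0=\Big\{b\in (L^2(\Omega))^n:\int_\Omega(\nabla u\cdot b+Hu)\,dx=0\ \text{ for all }u\in\mathring H^1(\Omega)\Big\}.$$ (i) The duality gap is zero: the values of $(P)$ and $(D)$ coincide in $[-\infty,\infty]$. (ii) If $(P)$ is bounded below, then $(D)$ has a solution $N\in\mathcal D_0$ with $\varphi^0(x,N(x))\le1$ for a.e. $x\in\Omega$ and $$\inf_{u\in\mathring H^1(\Omega)}\int_\Omega\big(\varphi(x,\nabla u+F)+Hu\big)\,dx=\int_\Omega F\cdot N\,dx .$$ Moreover, with this same $N$, every minimizer $u$ of $(P)$ satisfies $$\varphi\Big(x,\frac{\nabla u+F}{|\nabla u+F|}\Big)=N\cdot\frac{\nabla u+F}{|\nabla u+F|}\qquad |\nabla u+F|\text{-a.e. in }\Omega,$$ where $|\nabla u+F|$ denotes the measure on $\Omega$ with density $|\nabla u+F|$ with respect to Lebesgue measure. -/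

import Mathlib

open MeasureTheory
open scoped ContDiff

noncomputable section

/-- Euclidean space `ℝⁿ`. -/
abbrev Rn (n : ℕ) : Type := EuclideanSpace ℝ (Fin n)

/-- The Hilbert space `L²(Ω)`. -/
abbrev L2 {n : ℕ} (Ω : Set (Rn n)) : Type := Lp ℝ 2 (volume.restrict Ω)

/-- The Hilbert space `(L²(Ω))ⁿ`. -/
abbrev L2Vec {n : ℕ} (Ω : Set (Rn n)) : Type := Lp (Rn n) 2 (volume.restrict Ω)

/-- `g` is the weak gradient of `u` on `Ω`: for every test function `ψ ∈ C_c^∞(Ω)` and every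
direction `v`, `∫_Ω u ∂_v ψ = - ∫_Ω ψ (g · v)`. -/
def HasWeakGradient {n : ℕ} (Ω : Set (Rn n)) (u : Rn n → ℝ) (g : Rn n → Rn n) : Prop :=
  ∀ ψ : Rn n → ℝ, ContDiff ℝ ∞ ψ → HasCompactSupport ψ → tsupport ψ ⊆ Ω → ∀ v : Rn n,
    ∫ x in Ω, u x * fderiv ℝ ψ x v = - ∫ x in Ω, ψ x * inner ℝ (g x) v

lemma integrable_mul_fderiv_test {n : ℕ} {Ω : Set (Rn n)} (u : L2 Ω) {ψ : Rn n → ℝ}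
    (hψ : ContDiff ℝ ∞ ψ) (hc : HasCompactSupport ψ) (v : Rn n) :
    Integrable (fun x => u x * fderiv ℝ ψ x v) (volume.restrict Ω) := by
  have hcont : Continuous (fun x => fderiv ℝ ψ x v) :=
    (hψ.continuous_fderiv (by simp)).clm_apply continuous_const
  have h2 : MemLp (fun x => fderiv ℝ ψ x v) 2 (volume.restrict Ω) :=
    hcont.memLp_of_hasCompactSupport (hc.fderiv_apply (𝕜 := ℝ) v)
  exact (Lp.memLp u).integrable_mul h2

lemma integrable_test_mul_inner {n : ℕ} {Ω : Set (Rn n)} (g : L2Vec Ω) {ψ : Rn n → ℝ}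
    (hψ : ContDiff ℝ ∞ ψ) (hc : HasCompactSupport ψ) (v : Rn n) :
    Integrable (fun x => ψ x * inner ℝ (g x) v) (volume.restrict Ω) := by
  have h1 : MemLp ψ 2 (volume.restrict Ω) :=
    hψ.continuous.memLp_of_hasCompactSupport hc
  have h2 : MemLp (fun x => inner ℝ (g x) v) 2 (volume.restrict Ω) :=
    (Lp.memLp g).inner_const v
  exact h1.integrable_mul h2

/-- The space of `u ∈ H¹(Ω)` with `∫_Ω u = 0`.  An element of `H¹(Ω)` is recorded as the pair
`(u, ∇u) ∈ L²(Ω) × (L²(Ω))ⁿ` of the function and its (unique) weak gradient; the Hilbert norm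
inherited from the product is the usual `H¹` norm `(‖u‖² + ‖∇u‖²)^{1/2}`. On a set of finite
measure the integrability clause is automatic. -/
def H1ZeroMean {n : ℕ} (Ω : Set (Rn n)) : Submodule ℝ (WithLp 2 (L2 Ω × L2Vec Ω)) where
  carrier := {w | HasWeakGradient Ω w.fst w.snd ∧
    Integrable w.fst (volume.restrict Ω) ∧ ∫ x in Ω, w.fst x = 0}
  zero_mem' := by
    have h1 : ((0 : L2 Ω) : Rn n → ℝ) =ᵐ[volume.restrict Ω] 0 := Lp.coeFn_zero _ _ _
    have h2 : ((0 : L2Vec Ω) : Rn n → Rn n) =ᵐ[volume.restrict Ω] 0 := Lp.coeFn_zero _ _ _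
    refine ⟨fun ψ _ _ _ v => ?_, ?_, ?_⟩
    · have e1 : ∫ x in Ω, ((0 : L2 Ω) : Rn n → ℝ) x * fderiv ℝ ψ x v = 0 := by
        rw [integral_congr_ae (g := fun _ => 0)]
        · simp
        · filter_upwards [h1] with x hx
          rw [hx, Pi.zero_apply, zero_mul]
      have e2 : ∫ x in Ω, ψ x * inner ℝ (((0 : L2Vec Ω) : Rn n → Rn n) x) v = 0 := by
        rw [integral_congr_ae (g := fun _ => 0)]
        · simp
        · filter_upwards [h2] with x hx
          rw [hx, Pi.zero_apply, inner_zero_left, mul_zero]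
      exact e1.trans (by rw [← neg_zero, ← e2]; rfl)
    · exact (integrable_zero _ _ _).congr h1.symm
    · exact (integral_congr_ae h1).trans (by simp)
  add_mem' := by
    rintro a b ⟨ha, hai, ha0⟩ ⟨hb, hbi, hb0⟩
    have h1 := Lp.coeFn_add a.fst b.fst
    have h2 := Lp.coeFn_add a.snd b.snd
    refine ⟨fun ψ hψ hc hs v => ?_, ?_, ?_⟩
    · have e1 : ∫ x in Ω, (a.fst + b.fst : L2 Ω) x * fderiv ℝ ψ x v =
          ∫ x in Ω, a.fst x * fderiv ℝ ψ x v + b.fst x * fderiv ℝ ψ x v := by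
        refine integral_congr_ae ?_
        filter_upwards [h1] with x hx
        rw [hx, Pi.add_apply, add_mul]
      have e2 : ∫ x in Ω, ψ x * inner ℝ ((a.snd + b.snd : L2Vec Ω) x) v =
          ∫ x in Ω, ψ x * inner ℝ (a.snd x) v + ψ x * inner ℝ (b.snd x) v := by
        refine integral_congr_ae ?_
        filter_upwards [h2] with x hx
        rw [hx, Pi.add_apply, inner_add_left, mul_add]
      rw [integral_add (integrable_mul_fderiv_test _ hψ hc v)
        (integrable_mul_fderiv_test _ hψ hc v), ha ψ hψ hc hs v, hb ψ hψ hc hs v] at e1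
      rw [integral_add (integrable_test_mul_inner _ hψ hc v)
        (integrable_test_mul_inner _ hψ hc v)] at e2
      exact e1.trans (by rw [← neg_add, ← e2]; rfl)
    · exact (hai.add hbi).congr h1.symm
    · refine (integral_congr_ae h1).trans ?_
      simp only [Pi.add_apply]
      rw [integral_add hai hbi, ha0, hb0, add_zero]
  smul_mem' := by
    rintro c a ⟨ha, hai, ha0⟩
    have h1 := Lp.coeFn_smul c a.fst
    have h2 := Lp.coeFn_smul c a.snd
    refine ⟨fun ψ hψ hc hs v => ?_, ?_, ?_⟩
    · have e1 : ∫ x in Ω, (c • a.fst : L2 Ω) x * fderiv ℝ ψ x v =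
          ∫ x in Ω, c * (a.fst x * fderiv ℝ ψ x v) := by
        refine integral_congr_ae ?_
        filter_upwards [h1] with x hx
        rw [hx, Pi.smul_apply, smul_eq_mul, mul_assoc]
      have e2 : ∫ x in Ω, ψ x * inner ℝ ((c • a.snd : L2Vec Ω) x) v =
          ∫ x in Ω, c * (ψ x * inner ℝ (a.snd x) v) := by
        refine integral_congr_ae ?_
        filter_upwards [h2] with x hx
        rw [hx, Pi.smul_apply, real_inner_smul_left]
        ring
      rw [integral_const_mul, ha ψ hψ hc hs v] at e1
      rw [integral_const_mul] at e2
      exact e1.trans (by rw [mul_neg, ← e2]; rfl)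
    · exact (hai.smul c).congr h1.symm
    · refine (integral_congr_ae h1).trans ?_
      simp only [Pi.smul_apply]
      rw [integral_smul, ha0, smul_zero]

/-- The function underlying an element of the space of mean-zero `H¹` functions. -/
def toL2 {n : ℕ} {Ω : Set (Rn n)} (u : H1ZeroMean Ω) : L2 Ω := u.1.fst

/-- The gradient operator `∇` from mean-zero `H¹(Ω)` to `(L²(Ω))ⁿ`, a bounded operator. -/
def grad {n : ℕ} (Ω : Set (Rn n)) : H1ZeroMean Ω →L[ℝ] L2Vec Ω :=
  (WithLp.sndL 2 ℝ (L2 Ω) (L2Vec Ω)).comp (H1ZeroMean Ω).subtypeL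

/-- The adjoint `∇*` from `(L²(Ω))ⁿ` (identified with its dual through the inner product) to the
dual of mean-zero `H¹(Ω)`: `(∇* b)(u) = ⟨b, ∇u⟩`. -/
def gradAdjoint {n : ℕ} (Ω : Set (Rn n)) (b : L2Vec Ω) : H1ZeroMean Ω →L[ℝ] ℝ :=
  (innerSL ℝ b).comp (grad Ω)

/-- The convex conjugate `f*(ℓ) = sup_v (ℓ(v) - f(v))`, with values in `[-∞, ∞]`. -/
def convexConjugate {V : Type*} [NormedAddCommGroup V] [NormedSpace ℝ V] (f : V → ℝ)
    (ℓ : V →L[ℝ] ℝ) : EReal :=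
  ⨆ v : V, ((ℓ v - f v : ℝ) : EReal)

/-- `p` is a norm on `ℝⁿ` (non-negativity is a consequence). -/
structure IsNormOn {n : ℕ} (p : Rn n → ℝ) : Prop where
  eq_zero_iff : ∀ ξ, p ξ = 0 ↔ ξ = 0
  smul : ∀ (c : ℝ) (ξ : Rn n), p (c • ξ) = |c| * p ξ
  add_le : ∀ ξ η, p (ξ + η) ≤ p ξ + p η

/-- The dual norm `φ⁰(x, ξ) = sup {ξ · p : φ(x, p) ≤ 1}`. -/
def dualNorm {n : ℕ} (φ : Rn n → Rn n → ℝ) (x ξ : Rn n) : ℝ :=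
  sSup {r : ℝ | ∃ p : Rn n, φ x p ≤ 1 ∧ r = inner ℝ ξ p}

/-- `E(b) = ∫_Ω φ(x, b + F) dx`. -/
def energyE {n : ℕ} (Ω : Set (Rn n)) (φ : Rn n → Rn n → ℝ) (F : Rn n → Rn n)
    (b : L2Vec Ω) : ℝ :=
  ∫ x in Ω, φ x (b x + F x)

/-- `G(u) = ∫_Ω H u dx`. -/
def energyG {n : ℕ} (Ω : Set (Rn n)) (H : Rn n → ℝ) (u : H1ZeroMean Ω) : ℝ :=
  ∫ x in Ω, H x * toL2 u x

/-- The primal functional `I(u) = E(∇u) + G(u)`. -/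
def primalFunctional {n : ℕ} (Ω : Set (Rn n)) (φ : Rn n → Rn n → ℝ) (F : Rn n → Rn n)
    (H : Rn n → ℝ) (u : H1ZeroMean Ω) : ℝ :=
  energyE Ω φ F (grad Ω u) + energyG Ω H u

/-- The Fenchel–Rockafellar dual functional `b ↦ -E*(b) - G*(-∇* b)` on `(L²(Ω))ⁿ`. -/
def dualFunctional {n : ℕ} (Ω : Set (Rn n)) (φ : Rn n → Rn n → ℝ) (F : Rn n → Rn n)
    (H : Rn n → ℝ) (b : L2Vec Ω) : EReal :=
  - convexConjugate (energyE Ω φ F) (innerSL ℝ b) -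
    convexConjugate (energyG Ω H) (-(gradAdjoint Ω b))

/-- `𝒟₀ = {b ∈ (L²(Ω))ⁿ : ∫_Ω (∇u · b + H u) = 0 for all mean-zero u ∈ H¹(Ω)}`. -/
def setD0 {n : ℕ} (Ω : Set (Rn n)) (H : Rn n → ℝ) : Set (L2Vec Ω) :=
  {b | ∀ u : H1ZeroMean Ω, ∫ x in Ω, (inner ℝ (grad Ω u x) (b x) + H x * toL2 u x) = 0}

/-- The measure `|Du + F|` on `Ω`, the total variation of the vector measure `(Du + F) dx`. -/
def totalVariationMeasure {n : ℕ} (Ω : Set (Rn n)) (F : Rn n → Rn n) (u : H1ZeroMean Ω) :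
    Measure (Rn n) :=
  (volume.restrict Ω).withDensity (fun x => ‖grad Ω u x + F x‖ₑ)

/-- The direction `(Du + F) / |Du + F|` at the point `x`. -/
def direction {n : ℕ} (Ω : Set (Rn n)) (F : Rn n → Rn n) (u : H1ZeroMean Ω) (x : Rn n) : Rn n :=
  ‖grad Ω u x + F x‖⁻¹ • (grad Ω u x + F x)

end

/-!
Write `p(w) = ∫_Ω φ(x, w) dx`, a seminorm on `(L²(Ω))ⁿ` bounded by a multiple of the norm because
`Ω` has finite measure. The primal functional is `u ↦ p(∇u + F) + G(u)` with `G` linear.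

If it is bounded below, then `q(w) = inf_u (p(∇u + w) + G(u))` is finite and sublinear, and
`q(F)` is the primal value. Hahn–Banach gives a linear form dominated by `q` that agrees with `q`
at `F` (`Seminorm.exists_dual_certificate`); since `q ≤ p` it is continuous, hence represented by
some `N`, and `q(-∇u) ≤ G(u)` for all `u` forces `⟨N, ∇u⟩ = -G(u)`, which is `N ∈ 𝒟₀`. Thus
`E*(N) ≤ -⟨N, F⟩` and `G*(-∇*N) ≤ 0`, so the dual value at `N` is at least the primal value;
Young's inequality for conjugates gives the converse. If the primal problem is unbounded below,
this inequality alone closes the gap. This argument needs neither closed range of `∇` nor a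
Poincaré inequality, whence no regularity of `Ω`.

Testing `⟨N, w⟩ ≤ p(w)` on `w = 1_A ξ` yields `N(x) · ξ ≤ φ(x, ξ)` for all `ξ`, almost everywhere
(`IsNormIntegrand.ae_inner_le`), which is the bound on the dual norm. For a minimizer `u` and
`w = ∇u + F`, the integrals of `N · w ≤ φ(x, w)` coincide, so the two sides agree almost everywhere.
-/

open Filter Topology

/-! ### Hahn–Banach and abstract duality -/

/-- A sublinear function has a supporting linear form at every point; the form is extended from
the line through `y₀`. -/
lemma exists_linearMap_le_sublinear_apply_eq {Y : Type*} [AddCommGroup Y] [Module ℝ Y]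
    (q : Y → ℝ) (q_hom : ∀ c : ℝ, 0 < c → ∀ y, q (c • y) = c * q y)
    (q_add : ∀ y z, q (y + z) ≤ q y + q z) (y₀ : Y) :
    ∃ g : Y →ₗ[ℝ] ℝ, (∀ y, g y ≤ q y) ∧ g y₀ = q y₀ := by
  have q_zero : q 0 = 0 := by
    have := q_hom 2 two_pos 0
    rw [smul_zero] at this
    linarith
  have hz : ∀ c : ℝ, c • y₀ = 0 → (RingHom.id ℝ c) • q y₀ = 0 := by
    intro c hc
    rcases smul_eq_zero.1 hc with rfl | rfl
    · simp
    · simp [q_zero]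
  obtain ⟨g, hg, hgq⟩ := exists_extension_of_le_sublinear
    (LinearPMap.mkSpanSingleton' (σ := RingHom.id ℝ) y₀ (q y₀) hz) q q_hom q_add (by
      rintro ⟨y, hy⟩
      obtain ⟨c, rfl⟩ := Submodule.mem_span_singleton.1 hy
      rw [LinearPMap.mkSpanSingleton'_apply]
      simp only [RingHom.id_apply, smul_eq_mul]
      rcases lt_trichotomy c 0 with hc | rfl | hc
      -- On the negative half-line the bound is `0 = q 0 ≤ q (c • y₀) + q (-c • y₀)`.
      · have h1 := q_hom (-c) (neg_pos.2 hc) y₀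
        have h2 := q_add (c • y₀) ((-c) • y₀)
        rw [← add_smul, add_neg_cancel, zero_smul, q_zero, h1] at h2
        linarith
      · simp [q_zero]
      · exact (q_hom c hc y₀).ge)
  refine ⟨g, hgq, ?_⟩
  exact (hg ⟨y₀, Submodule.mem_span_singleton_self y₀⟩).trans
    (LinearPMap.mkSpanSingleton'_apply_self _ _ _ _)

/-- Strong duality for a functional `u ↦ p (A u + y) + G u` built from a seminorm and linear maps.
The linear form comes from Hahn–Banach, applied at `y` to the sublinear
function `w ↦ ⨅ u, p (A u + w) + G u`; domination by its values at `± A u` forces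
`g ∘ A = - G`. -/
theorem Seminorm.exists_dual_certificate {V Y : Type*} [AddCommGroup V] [Module ℝ V]
    [AddCommGroup Y] [Module ℝ Y] (p : Seminorm ℝ Y) (A : V →ₗ[ℝ] Y) (G : V →ₗ[ℝ] ℝ) (y : Y)
    (hb : BddBelow (Set.range fun u => p (A u + y) + G u)) :
    ∃ g : Y →ₗ[ℝ] ℝ, (∀ w, g w ≤ p w) ∧ (∀ u, g (A u) = - G u) ∧
      g y = ⨅ u, (p (A u + y) + G u) := by
  obtain ⟨m, hm⟩ := hb
  -- Boundedness below along the ray `t • u` forces the recession function to be nonnegative.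
  have hpos : ∀ u, 0 ≤ p (A u) + G u := by
    intro u
    by_contra! hneg
    set c := p (A u) + G u
    have hq : 0 < (|m| + p y + 1) / (-c) :=
      div_pos (by have := apply_nonneg p y; positivity) (by linarith)
    set t := (|m| + p y + 1) / (-c) with ht
    have htc : t * c = -(|m| + p y + 1) := by
      rw [ht, div_neg, neg_mul, div_mul_cancel₀ _ hneg.ne]
    have h1 : m ≤ p (A (t • u) + y) + G (t • u) := hm ⟨_, rfl⟩
    have h2 := map_add_le_add p (A (t • u)) y
    rw [map_smul, map_smul_eq_mul, Real.norm_of_nonneg hq.le] at h2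
    rw [map_smul G, smul_eq_mul, map_smul] at h1
    have h3 : t * c = t * p (A u) + t * G u := mul_add _ _ _
    linarith [neg_abs_le m]
  have hbdd : ∀ w, BddBelow (Set.range fun u => p (A u + w) + G u) := by
    intro w
    refine ⟨-p w, ?_⟩
    rintro _ ⟨u, rfl⟩
    have h1 := map_sub_le_add p (A u + w) w
    rw [add_sub_cancel_right] at h1
    have := hpos u
    dsimp only
    linarith
  have hle : ∀ w u, (⨅ u, (p (A u + w) + G u)) ≤ p (A u + w) + G u := fun w u => ciInf_le (hbdd w) u
  have hhom : ∀ c : ℝ, 0 < c → ∀ w,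
      (⨅ u, (p (A u + c • w) + G u)) = c * ⨅ u, (p (A u + w) + G u) := by
    intro c hc w
    rw [Real.mul_iInf_of_nonneg hc.le, ← (Equiv.smulRight hc.ne' : V ≃ V).iInf_comp]
    refine iInf_congr fun u => ?_
    simp only [Equiv.smulRight_apply, map_smul, ← smul_add, map_smul_eq_mul,
      Real.norm_of_nonneg hc.le, smul_eq_mul, mul_add]
  have hadd : ∀ w z, (⨅ u, (p (A u + (w + z)) + G u)) ≤
      (⨅ u, (p (A u + w) + G u)) + ⨅ u, (p (A u + z) + G u) := by
    intro w z
    refine le_ciInf_add_ciInf fun u v => (hle _ (u + v)).trans ?_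
    have := map_add_le_add p (A u + w) (A v + z)
    rw [add_add_add_comm] at this
    rw [map_add A, map_add G]
    linarith
  obtain ⟨g, hg, hgy⟩ := exists_linearMap_le_sublinear_apply_eq
    (fun w => ⨅ u, (p (A u + w) + G u)) hhom hadd y
  have hgA : ∀ u, - G u ≤ g (A u) := by
    intro u
    have := (hg (-A u)).trans (hle _ u)
    rw [add_neg_cancel, map_zero, map_neg] at this
    linarith
  refine ⟨g, fun w => ?_, fun u => le_antisymm ?_ (hgA u), hgy⟩
  · simpa using (hg w).trans (hle w 0)
  · have := hgA (-u)
    rw [map_neg, map_neg, map_neg] at this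
    linarith

/-! ### Integrals of measurable fields of norms -/

namespace MeasureTheory

/-- The superposition of a Carathéodory function and a measurable function is measurable: this is
clear for simple functions, and continuity passes it to their limits. -/
lemma AEStronglyMeasurable.comp_caratheodory {X E : Type*} [MeasurableSpace X]
    [TopologicalSpace E] {μ : Measure X} {ψ : X → E → ℝ}
    (hm : ∀ ξ, AEStronglyMeasurable (fun x => ψ x ξ) μ) (hc : ∀ᵐ x ∂μ, Continuous (ψ x))
    {b : X → E} (hb : AEStronglyMeasurable b μ) :
    AEStronglyMeasurable (fun x => ψ x (b x)) μ := by
  have hs : ∀ s : SimpleFunc X E, AEStronglyMeasurable (fun x => ψ x (s x)) μ := by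
    intro s
    have h : (fun x => ψ x (s x)) =
        fun x => ∑ c ∈ s.range, (s ⁻¹' {c}).indicator (fun x => ψ x c) x := by
      funext x
      rw [Finset.sum_eq_single (s x)]
      · simp
      · intro c _ hcx
        exact Set.indicator_of_notMem (s := s ⁻¹' {c}) (fun h => hcx h.symm) (fun x => ψ x c)
      · exact fun h => absurd (SimpleFunc.mem_range_self s x) h
    rw [h]
    exact Finset.aestronglyMeasurable_fun_sum _ fun c _ =>
      (hm c).indicator (s.measurableSet_fiber c)
  have hlim : AEStronglyMeasurable (fun x => ψ x (hb.mk b x)) μ := by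
    refine aestronglyMeasurable_of_tendsto_ae atTop
      (fun k => hs (hb.stronglyMeasurable_mk.approx k)) ?_
    filter_upwards [hc] with x hx
    exact (hx.tendsto _).comp (hb.stronglyMeasurable_mk.tendsto_approx x)
  refine hlim.congr ?_
  filter_upwards [hb.ae_eq_mk] with x hx
  rw [hx]

end MeasureTheory

section NormIntegrand

variable {n : ℕ}

lemma IsNormOn.nonneg {p : Rn n → ℝ} (hp : IsNormOn p) (ξ : Rn n) : 0 ≤ p ξ := by
  have h1 := hp.add_le ξ ((-1 : ℝ) • ξ)
  have h2 := hp.smul (-1) ξ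
  have h3 : ξ + (-1 : ℝ) • ξ = 0 := by simp
  rw [h3, (hp.eq_zero_iff 0).2 rfl, h2] at h1
  norm_num at h1
  linarith

lemma IsNormOn.continuous {p : Rn n → ℝ} (hp : IsNormOn p) {α : ℝ} (hα : ∀ ξ, p ξ ≤ α * ‖ξ‖) :
    Continuous p := by
  refine (LipschitzWith.of_le_add_mul α.toNNReal fun ξ η => ?_).continuous
  have h := hp.add_le η (ξ - η)
  rw [add_sub_cancel] at h
  rw [dist_eq_norm]
  have h2 : α * ‖ξ - η‖ ≤ α.toNNReal * ‖ξ - η‖ := by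
    gcongr
    exact Real.le_coe_toNNReal α
  linarith [hα (ξ - η)]

/-- `φ` is a measurable field of norms on `ℝⁿ`, dominated by `α` times the Euclidean norm, off a
`μ`-null set. -/
structure IsNormIntegrand (μ : Measure (Rn n)) (φ : Rn n → Rn n → ℝ) (α : ℝ) : Prop where
  meas : ∀ ξ, AEStronglyMeasurable (fun x => φ x ξ) μ
  le : ∀ᵐ x ∂μ, ∀ ξ, φ x ξ ≤ α * ‖ξ‖
  isNorm : ∀ᵐ x ∂μ, IsNormOn (φ x)

variable {μ : Measure (Rn n)} {φ : Rn n → Rn n → ℝ} {α : ℝ}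

lemma IsNormIntegrand.continuous (h : IsNormIntegrand μ φ α) : ∀ᵐ x ∂μ, Continuous (φ x) := by
  filter_upwards [h.le, h.isNorm] with x h1 h2 using h2.continuous h1

lemma IsNormIntegrand.integrable (h : IsNormIntegrand μ φ α) {b : Rn n → Rn n}
    (hb : Integrable b μ) : Integrable (fun x => φ x (b x)) μ := by
  refine (hb.norm.const_mul α).mono'
    (AEStronglyMeasurable.comp_caratheodory h.meas h.continuous hb.aestronglyMeasurable) ?_
  filter_upwards [h.le, h.isNorm] with x h1 h2
  rw [Real.norm_of_nonneg (h2.nonneg _)]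
  exact h1 _

variable [IsFiniteMeasure μ]

lemma integrable_of_L2Vec (b : Lp (Rn n) 2 μ) : Integrable b μ :=
  (Lp.memLp b).integrable one_le_two

/-- The seminorm `b ↦ ∫ φ(x, b(x)) dμ` on `L²(μ; ℝⁿ)`. -/
noncomputable def IsNormIntegrand.seminorm (h : IsNormIntegrand μ φ α) : Seminorm ℝ (Lp (Rn n) 2 μ) :=
  Seminorm.of (fun b => ∫ x, φ x (b x) ∂μ)
    (fun a b => by
      rw [← integral_add (h.integrable (integrable_of_L2Vec a))
        (h.integrable (integrable_of_L2Vec b))]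
      refine integral_mono_ae (h.integrable (integrable_of_L2Vec (a + b)))
        ((h.integrable (integrable_of_L2Vec a)).add (h.integrable (integrable_of_L2Vec b))) ?_
      filter_upwards [h.isNorm, Lp.coeFn_add a b] with x h1 h2
      rw [h2]
      exact h1.add_le _ _)
    (fun c b => by
      rw [← integral_const_mul]
      refine integral_congr_ae ?_
      filter_upwards [h.isNorm, Lp.coeFn_smul c b] with x h1 h2
      rw [h2]
      exact h1.smul _ _)

lemma IsNormIntegrand.seminorm_apply (h : IsNormIntegrand μ φ α) (b : Lp (Rn n) 2 μ) :
    h.seminorm b = ∫ x, φ x (b x) ∂μ := rfl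

lemma IsNormIntegrand.exists_seminorm_le (h : IsNormIntegrand μ φ α) (hα : 0 ≤ α) :
    ∃ C : ℝ, ∀ b, h.seminorm b ≤ C * ‖b‖ := by
  refine ⟨α * (μ Set.univ ^ (1 / (1 : ENNReal).toReal - 1 / (2 : ENNReal).toReal)).toReal,
    fun b => ?_⟩
  have h1 : h.seminorm b ≤ α * ∫ x, ‖b x‖ ∂μ := by
    rw [h.seminorm_apply, ← integral_const_mul]
    refine integral_mono_ae (h.integrable (integrable_of_L2Vec b))
      ((integrable_of_L2Vec b).norm.const_mul α) ?_
    filter_upwards [h.le] with x hx using hx _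
  have h2 : ∫ x, ‖b x‖ ∂μ = (eLpNorm b 1 μ).toReal := by
    rw [eLpNorm_one_eq_lintegral_enorm, integral_norm_eq_lintegral_enorm (Lp.aestronglyMeasurable b)]
  have h3 := eLpNorm_le_eLpNorm_mul_rpow_measure_univ (p := 1) (q := 2) one_le_two
    (Lp.aestronglyMeasurable b)
  have h4 := ENNReal.toReal_mono (ENNReal.mul_ne_top (Lp.eLpNorm_ne_top b)
    (ENNReal.rpow_ne_top_of_nonneg (by norm_num) (measure_ne_top μ _))) h3
  rw [ENNReal.toReal_mul, ← Lp.norm_def] at h4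
  calc h.seminorm b ≤ α * ∫ x, ‖b x‖ ∂μ := h1
    _ ≤ α * (‖b‖ * _) := by rw [h2]; gcongr
    _ = _ := by ring

/-- Domination of `⟨N, ·⟩` by the integral functional localizes: testing with `ξ` times indicator
functions gives the inequality for each fixed `ξ`, and continuity in `ξ` makes the null set
independent of `ξ`. -/
lemma IsNormIntegrand.ae_inner_le (h : IsNormIntegrand μ φ α) {N : Lp (Rn n) 2 μ}
    (hN : ∀ w, inner ℝ N w ≤ h.seminorm w) : ∀ᵐ x ∂μ, ∀ ξ, inner ℝ (N x) ξ ≤ φ x ξ := by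
  have hξ : ∀ ξ : Rn n, ∀ᵐ x ∂μ, inner ℝ (N x) ξ ≤ φ x ξ := by
    intro ξ
    refine ae_le_of_forall_setIntegral_le ((integrable_of_L2Vec N).inner_const ξ)
      (h.integrable (integrable_const ξ)) fun s hs hμs => ?_
    have h1 := hN (indicatorConstLp 2 hs hμs.ne ξ)
    rw [real_inner_comm, L2.inner_indicatorConstLp_eq_setIntegral_inner, h.seminorm_apply] at h1
    refine le_trans (le_of_eq ?_) (h1.trans (le_of_eq ?_))
    · simp_rw [real_inner_comm]
    · rw [← integral_indicator hs]
      refine integral_congr_ae ?_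
      filter_upwards [h.isNorm, indicatorConstLp_coeFn (p := 2) (hs := hs) (hμs := hμs.ne)
        (c := ξ)] with x h2 h3
      rw [h3]
      by_cases hx : x ∈ s
      · simp [hx]
      · simp [hx, (h2.eq_zero_iff 0).2 rfl]
  have hd : ∀ᵐ x ∂μ, ∀ k : ℕ, inner ℝ (N x) (TopologicalSpace.denseSeq (Rn n) k) ≤
      φ x (TopologicalSpace.denseSeq (Rn n) k) := ae_all_iff.2 fun k => hξ _
  filter_upwards [hd, h.continuous] with x h1 h2 ξ
  have hcl : IsClosed {ξ : Rn n | inner ℝ (N x) ξ ≤ φ x ξ} :=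
    isClosed_le (continuous_const.inner continuous_id) h2
  exact (TopologicalSpace.denseRange_denseSeq (Rn n)).induction_on (p := fun ξ =>
    inner ℝ (N x) ξ ≤ φ x ξ) ξ hcl h1

lemma dualNorm_le_one {x η : Rn n} (h0 : φ x 0 = 0) (h : ∀ ξ, inner ℝ η ξ ≤ φ x ξ) :
    dualNorm φ x η ≤ 1 := by
  refine csSup_le ⟨0, 0, by simp [h0], by simp⟩ ?_
  rintro _ ⟨p, hp, rfl⟩
  exact (h p).trans hp

/-- Equality of the integrals of `N · w ≤ φ(x, w)` forces pointwise equality, which homogeneity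
carries to the unit vector `w / |w|`. -/
lemma IsNormIntegrand.ae_apply_direction_eq (h : IsNormIntegrand μ φ α) {N w : Lp (Rn n) 2 μ}
    (hN : ∀ᵐ x ∂μ, ∀ ξ, inner ℝ (N x) ξ ≤ φ x ξ) (heq : h.seminorm w = inner ℝ N w) :
    ∀ᵐ x ∂μ, φ x (‖w x‖⁻¹ • w x) = inner ℝ (N x) (‖w x‖⁻¹ • w x) := by
  have hiφ := h.integrable (integrable_of_L2Vec w)
  have hiN : Integrable (fun x => inner ℝ (N x) (w x)) μ := L2.integrable_inner N w
  have h0 : ∫ x, (φ x (w x) - inner ℝ (N x) (w x)) ∂μ = 0 := by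
    rw [integral_sub hiφ hiN, ← h.seminorm_apply, heq, L2.inner_def, sub_self]
  have hnonneg : 0 ≤ᵐ[μ] fun x => φ x (w x) - inner ℝ (N x) (w x) := by
    filter_upwards [hN] with x hx
    exact sub_nonneg.2 (hx _)
  filter_upwards [(integral_eq_zero_iff_of_nonneg_ae hnonneg (hiφ.sub hiN)).1 h0, h.isNorm]
    with x h1 h2
  rw [h2.smul, inner_smul_right, abs_of_nonneg (by positivity), sub_eq_zero.1 h1]

end NormIntegrand

/-! ### The primal and dual functionals -/

section Duality

variable {n : ℕ} {Ω : Set (Rn n)} {φ : Rn n → Rn n → ℝ} {F : Rn n → Rn n} {H : Rn n → ℝ}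

lemma dualFunctional_le_primalFunctional (b : L2Vec Ω) (u : H1ZeroMean Ω) :
    dualFunctional Ω φ F H b ≤ (primalFunctional Ω φ F H u : EReal) := by
  have h1 : ((inner ℝ b (grad Ω u) - energyE Ω φ F (grad Ω u) : ℝ) : EReal) ≤
      convexConjugate (energyE Ω φ F) (innerSL ℝ b) :=
    le_iSup (fun v => ((innerSL ℝ b v - energyE Ω φ F v : ℝ) : EReal)) (grad Ω u)
  have h2 : ((-inner ℝ b (grad Ω u) - energyG Ω H u : ℝ) : EReal) ≤
      convexConjugate (energyG Ω H) (-(gradAdjoint Ω b)) :=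
    le_iSup (fun v => (((-(gradAdjoint Ω b)) v - energyG Ω H v : ℝ) : EReal)) u
  refine (EReal.sub_le_sub (EReal.neg_le_neg_iff.2 h1) h2).trans (le_of_eq ?_)
  rw [← EReal.coe_neg, ← EReal.coe_sub, primalFunctional]
  congr 1
  ring

/-- The functional `G`, as a linear form. -/
noncomputable def linearG (Ω : Set (Rn n)) {H : Rn n → ℝ} (hH : MemLp H 2 (volume.restrict Ω)) :
    H1ZeroMean Ω →ₗ[ℝ] ℝ :=
  (innerₗ (L2 Ω) hH.toLp) ∘ₗ
    ((WithLp.fstL 2 ℝ (L2 Ω) (L2Vec Ω)).comp (H1ZeroMean Ω).subtypeL).toLinearMap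

lemma linearG_apply (hH : MemLp H 2 (volume.restrict Ω)) (u : H1ZeroMean Ω) :
    linearG Ω hH u = energyG Ω H u := by
  change inner ℝ hH.toLp (toL2 u) = _
  rw [L2.inner_def, energyG]
  refine integral_congr_ae ?_
  filter_upwards [hH.coeFn_toLp] with x hx
  rw [hx, real_inner_comm]
  rfl

lemma mem_setD0_of_inner_grad_eq (hH : MemLp H 2 (volume.restrict Ω)) {N : L2Vec Ω}
    (hG : ∀ u, inner ℝ N (grad Ω u) = -energyG Ω H u) : N ∈ setD0 Ω H := by
  intro u
  have hHu : Integrable (fun x => H x * toL2 u x) (volume.restrict Ω) :=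
    hH.integrable_mul (Lp.memLp (toL2 u))
  rw [integral_add (L2.integrable_inner (grad Ω u) N) hHu, ← L2.inner_def, real_inner_comm, hG u]
  exact neg_add_cancel _

variable [IsFiniteMeasure (volume.restrict Ω)] {α : ℝ}

lemma energyE_eq_seminorm (h : IsNormIntegrand (volume.restrict Ω) φ α)
    (hF : MemLp F 2 (volume.restrict Ω)) (b : L2Vec Ω) :
    energyE Ω φ F b = h.seminorm (b + hF.toLp) := by
  rw [energyE, h.seminorm_apply]
  refine integral_congr_ae ?_
  filter_upwards [Lp.coeFn_add b hF.toLp, hF.coeFn_toLp] with x h1 h2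
  rw [h1, Pi.add_apply, h2]

lemma primalFunctional_eq (h : IsNormIntegrand (volume.restrict Ω) φ α)
    (hF : MemLp F 2 (volume.restrict Ω)) (hH : MemLp H 2 (volume.restrict Ω))
    (u : H1ZeroMean Ω) :
    primalFunctional Ω φ F H u = h.seminorm (grad Ω u + hF.toLp) + linearG Ω hH u := by
  rw [primalFunctional, energyE_eq_seminorm h hF, linearG_apply]

/-- A vector field that is admissible for the dual problem has dual value at least `∫ F · N`. -/
lemma inner_le_dualFunctional (h : IsNormIntegrand (volume.restrict Ω) φ α)
    (hF : MemLp F 2 (volume.restrict Ω)) {N : L2Vec Ω} (hN : ∀ w, inner ℝ N w ≤ h.seminorm w)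
    (hG : ∀ u, inner ℝ N (grad Ω u) = -energyG Ω H u) :
    ((inner ℝ N hF.toLp : ℝ) : EReal) ≤ dualFunctional Ω φ F H N := by
  have h1 : convexConjugate (energyE Ω φ F) (innerSL ℝ N) ≤
      ((-inner ℝ N hF.toLp : ℝ) : EReal) := by
    refine iSup_le fun v => EReal.coe_le_coe_iff.2 ?_
    have := hN (v + hF.toLp)
    rw [inner_add_right] at this
    rw [energyE_eq_seminorm h hF, innerSL_apply_apply]
    linarith
  have h2 : convexConjugate (energyG Ω H) (-(gradAdjoint Ω N)) ≤ ((0 : ℝ) : EReal) := by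
    refine iSup_le fun u => EReal.coe_le_coe_iff.2 ?_
    change -inner ℝ N (grad Ω u) - energyG Ω H u ≤ 0
    rw [hG]
    linarith
  refine le_trans (le_of_eq ?_) (EReal.sub_le_sub (EReal.neg_le_neg_iff.2 h1) h2)
  rw [← EReal.coe_neg, ← EReal.coe_sub]
  simp

/-- If the primal problem is bounded below, there is an admissible dual field attaining the primal
value. -/
lemma exists_dual_field (h : IsNormIntegrand (volume.restrict Ω) φ α) (hα : 0 ≤ α)
    (hF : MemLp F 2 (volume.restrict Ω)) (hH : MemLp H 2 (volume.restrict Ω))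
    (hb : BddBelow (Set.range (primalFunctional Ω φ F H))) :
    ∃ N : L2Vec Ω, (∀ w, inner ℝ N w ≤ h.seminorm w) ∧
      (∀ u, inner ℝ N (grad Ω u) = -energyG Ω H u) ∧
      inner ℝ N hF.toLp = ⨅ u, primalFunctional Ω φ F H u := by
  have hfun : primalFunctional Ω φ F H = fun u =>
      h.seminorm ((grad Ω).toLinearMap u + hF.toLp) + linearG Ω hH u :=
    funext fun u => primalFunctional_eq h hF hH u
  rw [hfun] at hb ⊢
  obtain ⟨g, hg, hgA, hgF⟩ := h.seminorm.exists_dual_certificate _ _ _ hb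
  obtain ⟨C, hC⟩ := h.exists_seminorm_le hα
  have hbound : ∀ w, ‖g w‖ ≤ C * ‖w‖ := by
    intro w
    rw [Real.norm_eq_abs, abs_le]
    have h1 := (hg (-w)).trans (hC (-w))
    rw [map_neg, norm_neg] at h1
    exact ⟨by linarith, (hg w).trans (hC w)⟩
  have hrep : ∀ w, inner ℝ ((InnerProductSpace.toDual ℝ (L2Vec Ω)).symm
      (g.mkContinuous C hbound)) w = g w := fun w => InnerProductSpace.toDual_symm_apply
  refine ⟨(InnerProductSpace.toDual ℝ (L2Vec Ω)).symm (g.mkContinuous C hbound), ?_, ?_, ?_⟩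
  · intro w
    rw [hrep]
    exact hg w
  · intro u
    rw [hrep, ← linearG_apply hH]
    exact hgA u
  · rw [hrep]
    exact hgF

end Duality

theorem mainTheorem2 {n : ℕ} (Ω : Set (Rn n)) (hΩo : IsOpen Ω) (hΩb : Bornology.IsBounded Ω)
    (F : Rn n → Rn n) (hF : MemLp F 2 (volume.restrict Ω))
    (H : Rn n → ℝ) (hH : MemLp H 2 (volume.restrict Ω))
    (φ : Rn n → Rn n → ℝ)
    (hφmeas : ∀ ξ : Rn n, AEStronglyMeasurable (fun x => φ x ξ) (volume.restrict Ω))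
    (hC1 : ∃ α : ℝ, 0 < α ∧ ∀ x ∈ Ω, ∀ ξ : Rn n, 0 ≤ φ x ξ ∧ φ x ξ ≤ α * ‖ξ‖)
    (hC2 : ∀ x ∈ Ω, IsNormOn (φ x)) :
    -- the duality gap is zero (in the extended reals)
    (⨅ u : H1ZeroMean Ω, ((primalFunctional Ω φ F H u : ℝ) : EReal)) =
        (⨆ b : L2Vec Ω, dualFunctional Ω φ F H b) ∧
    -- if the primal problem is bounded below, the dual problem has a solution `N`
    (BddBelow (Set.range (primalFunctional Ω φ F H)) →
      ∃ N : L2Vec Ω,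
        (∀ b : L2Vec Ω, dualFunctional Ω φ F H b ≤ dualFunctional Ω φ F H N) ∧
        N ∈ setD0 Ω H ∧
        (∀ᵐ x ∂(volume.restrict Ω), dualNorm φ x (N x) ≤ 1) ∧
        (⨅ u : H1ZeroMean Ω, primalFunctional Ω φ F H u) = ∫ x in Ω, inner ℝ (F x) (N x) ∧
        -- the structure of every minimizer
        ∀ u : H1ZeroMean Ω, (∀ v : H1ZeroMean Ω,
            primalFunctional Ω φ F H u ≤ primalFunctional Ω φ F H v) →
          ∀ᵐ x ∂(totalVariationMeasure Ω F u),
            φ x (direction Ω F u x) = inner ℝ (N x) (direction Ω F u x)) := by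
  obtain ⟨α, hα, hC1⟩ := hC1
  have : IsFiniteMeasure (volume.restrict Ω) :=
    ⟨by rw [Measure.restrict_apply_univ]; exact hΩb.measure_lt_top⟩
  have h : IsNormIntegrand (volume.restrict Ω) φ α :=
    ⟨hφmeas, ae_restrict_of_forall_mem hΩo.measurableSet fun x hx ξ => (hC1 x hx ξ).2,
      ae_restrict_of_forall_mem hΩo.measurableSet hC2⟩
  have hweak : (⨆ b : L2Vec Ω, dualFunctional Ω φ F H b) ≤
      ⨅ u : H1ZeroMean Ω, ((primalFunctional Ω φ F H u : ℝ) : EReal) :=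
    iSup_le fun b => le_iInf fun u => dualFunctional_le_primalFunctional b u
  refine ⟨le_antisymm ?_ hweak, fun hb => ?_⟩
  · by_cases hb : BddBelow (Set.range (primalFunctional Ω φ F H))
    · obtain ⟨N, hN, hG, hm⟩ := exists_dual_field h hα.le hF hH hb
      refine le_trans ?_ ((inner_le_dualFunctional h hF hN hG).trans (le_iSup _ N))
      refine EReal.le_of_forall_lt_iff_le.1 fun z hz => ?_
      rw [hm, EReal.coe_lt_coe_iff] at hz
      obtain ⟨u, hu⟩ := exists_lt_of_ciInf_lt hz
      exact (iInf_le _ u).trans (EReal.coe_le_coe_iff.2 hu.le)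
    · refine le_trans (le_of_eq (EReal.eq_bot_iff_forall_lt _ |>.2 fun y => ?_)) bot_le
      obtain ⟨_, ⟨u, rfl⟩, hu⟩ := not_bddBelow_iff.1 hb y
      exact (iInf_le _ u).trans_lt (EReal.coe_lt_coe_iff.2 hu)
  · obtain ⟨N, hN, hG, hm⟩ := exists_dual_field h hα.le hF hH hb
    have hae := h.ae_inner_le hN
    refine ⟨N, fun b => ?_, mem_setD0_of_inner_grad_eq hH hG, ?_, ?_, fun u hu => ?_⟩
    · refine le_trans ?_ (inner_le_dualFunctional h hF hN hG)
      refine EReal.le_of_forall_lt_iff_le.1 fun z hz => ?_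
      rw [hm, EReal.coe_lt_coe_iff] at hz
      obtain ⟨u, hu⟩ := exists_lt_of_ciInf_lt hz
      exact (dualFunctional_le_primalFunctional b u).trans (EReal.coe_le_coe_iff.2 hu.le)
    · filter_upwards [hae, h.isNorm] with x h1 h2
      exact dualNorm_le_one ((h2.eq_zero_iff 0).2 rfl) h1
    · rw [← hm, real_inner_comm, L2.inner_def]
      refine integral_congr_ae ?_
      filter_upwards [hF.coeFn_toLp] with x hx
      rw [hx]
    · have hmin : primalFunctional Ω φ F H u = inner ℝ N hF.toLp := by
        rw [hm]
        exact le_antisymm (le_ciInf hu) (ciInf_le hb u)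
      have heq : h.seminorm (grad Ω u + hF.toLp) = inner ℝ N (grad Ω u + hF.toLp) := by
        rw [inner_add_right, hG, ← hmin, primalFunctional, energyE_eq_seminorm h hF]
        ring
      refine (withDensity_absolutelyContinuous _ _).ae_le ?_
      filter_upwards [h.ae_apply_direction_eq hae heq, Lp.coeFn_add (grad Ω u) hF.toLp,
        hF.coeFn_toLp] with x h1 h2 h3
      rw [h2, Pi.add_apply, h3] at h1
      exact h1
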